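/- Let $\mathcal X$ be a measurable space. For a probability distribution $P$ on $\mathcal X\times[0,1]$, with $(X,Y)\sim P$, and a measurable $f:\mathcal X\to[0,1]$, let $$\Delta^P_{\mathrm{ECE}}(f)=\mathbb E_P\big[\,|\mathbb E_P[Y\mid f(X)]-f(X)|\,\big]$$ be the expected calibration error. For $\gamma\in[0,1]$ define the effective variability $$\sigma^2_\gamma(P)=\inf\big\{\mathbb E_P[\mathrm{Var}(Y\mid X)\,\mathbf 1\{X\in A\}] : A\subseteq\mathcal X \text{ measurable},\ \mathbb P_P(X\in A)\ge\gamma\big\}$$ and the effective support size $$S_\gamma(f,P)=\inf\big\{k\ge 1 : \mathbb P_P\big(f(X)\in\{t_1,\dots,t_k\}\big)\ge 1-\gamma \text{ for some } t_1,\dots,t_k\in[0,1]\big\},$$ with $S_\gamma(f,P)=+\infty$ if the set is empty. Let $\mathcal A:\bigcup_{n\ge 0}(\mathcal X\times[0,1])^n\to\{\text{measurable functions }\mathcal X\to[0,1]\}$ be an algorithm such that, for each $n$, the map $(D,x)\mapsto \mathcal A(D)(x)$ is measurable on $(\mathcal X\times[0,1])^n\times\mathcal X$. For $D_n=((X_i,Y_i))_{i\le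 n}\sim P^n$ write $f_n=\mathcal A(D_n)$. Suppose that $\mathcal A$ is strongly asymptotically ECE-calibrated, that is, $$\limsup_{n\to\infty}\ \sup_P\ \mathbb E_{P^n}\big[\Delta^P_{\mathrm{ECE}}(f_n)\big]=0,$$ where the supremum is over all probability distributions $P$ on $\mathcal X\times[0,1]$. Then there is a real sequence $\nu_n\to0$ (depending only on $\mathcal A$) such that, for every $n$, every probability distribution $P$ on $\mathcal X\times[0,1]$ and every $\gamma\in[0,1]$ with $\sigma^2_\gamma(P)>0$, $$\mathbb P_{P^n}\big\{S_\gamma(f_n,P)\le n^2\big\}\ \ge\ 1-\frac{\nu_n}{\sigma^2_\gamma(P)} .$$ In $S_\gamma(f_n,P)$ and $\Delta^P_{\mathrm{ECE}}(f_n)$ the fitted function $f_n$ is treated as fixed. (When $\sigma^2_\gamma(P)=0$ the bound is vacuous.) -/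

import Mathlib

open MeasureTheory ProbabilityTheory Filter Topology
open scoped ENNReal unitInterval

noncomputable section

namespace Calibration

variable {𝒳 : Type*} [MeasurableSpace 𝒳]

/-- The label `Y`, as a real random variable on the space `𝒳 × [0,1]` of pairs `(X, Y)`. -/
def label (z : 𝒳 × I) : ℝ := (z.2 : ℝ)

/-- Expected Calibration Error `E_P |E_P[Y | f(X)] - f(X)|` of the forecast `f` for `(X, Y) ∼ P`. -/
def ece (P : Measure (𝒳 × I)) (f : 𝒳 → I) : ℝ :=
  ∫ z, |(P[label | MeasurableSpace.comap (fun z : 𝒳 × I => f z.1) inferInstance]) z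
      - (f z.1 : ℝ)| ∂P

/-- Effective variability `σ²_γ(P)`: the infimum of `E_P[Var(Y | X) 1{X ∈ A}]` over the measurable
sets `A ⊆ 𝒳` with `P(X ∈ A) ≥ γ`. -/
def effVar (γ : ℝ) (P : Measure (𝒳 × I)) : ℝ :=
  sInf {v : ℝ | ∃ A : Set 𝒳, MeasurableSet A ∧ γ ≤ P.real {z | z.1 ∈ A} ∧
    v = ∫ z in {z : 𝒳 × I | z.1 ∈ A},
      (Var[label; P | MeasurableSpace.comap (Prod.fst : 𝒳 × I → 𝒳) inferInstance]) z ∂P}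

/-- Effective support size `S_γ(f, P)`: the least `k ≥ 1` such that `f(X)` lies in some `k`-point
list of values with `P`-probability at least `1 - γ`, and `∞` if there is no such `k`. -/
def effSupp (γ : ℝ) (f : 𝒳 → I) (P : Measure (𝒳 × I)) : ℕ∞ :=
  ⨅ (k : ℕ) (_ : 1 ≤ k ∧ ∃ t : Fin k → I, 1 - γ ≤ P.real {z | f z.1 ∈ Set.range t}), (k : ℕ∞)

variable (𝒳) in
/-- An algorithm: for each sample size `n`, a map from data sets in `(𝒳 × [0,1])ⁿ` to measurable
functions `𝒳 → [0,1]`. -/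
abbrev Algorithm : Type _ := (n : ℕ) → (Fin n → 𝒳 × I) → {f : 𝒳 → I // Measurable f}

/-- The law `Pⁿ` of `n` i.i.d. draws from `P`. -/
abbrev iidLaw (n : ℕ) (P : Measure (𝒳 × I)) : Measure (Fin n → 𝒳 × I) :=
  Measure.pi fun _ => P

/-- Joint measurability of `(D, x) ↦ f_D(x)`, where `f_D` is the function fitted to the data `D`;
it is what makes expectations and probabilities over the data meaningful. -/
def Algorithm.JointlyMeasurable (𝒜 : Algorithm 𝒳) : Prop :=
  ∀ n, Measurable fun p : (Fin n → 𝒳 × I) × 𝒳 => (𝒜 n p.1).1 p.2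

/-- Strong asymptotic ECE-calibration: `limsup_n sup_P E_{Pⁿ}[ECE_P(f_n)] = 0`, the supremum being
over all probability distributions on `𝒳 × [0,1]`. -/
def Algorithm.StronglyAsympCalibrated (𝒜 : Algorithm 𝒳) : Prop :=
  limsup (fun n : ℕ => ⨆ (P : Measure (𝒳 × I)) (_ : IsProbabilityMeasure P),
    ∫⁻ D, ENNReal.ofReal (ece P (𝒜 n D).1) ∂(iidLaw n P)) atTop = 0

end Calibration

end

/-! ### Residuals on level sets and the calibration error -/

namespace Calibration

variable {𝒳 : Type*}

/-! Under `P` itself, label noise averages out over a level set of the forecast, so a large support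
need not cost any calibration error. Under an empirical law it does: a sample point alone in its
level set contributes its whole residual (`sum_isolatedLoss_le_ece`). Calibration is uniform over
all laws, so it applies to the empirical law of a ghost sample `w` of `N = 2n²` draws from `P`.
Training on that law means training on `w ∘ s` with `s` a uniform tuple of indices
(`lintegral_iidLaw_empirical`). With probability at least 1/2, `s` is injective, and then `w ∘ s` is
an i.i.d. sample from `P`, independent of the other points of `w`, which are at least half of them.
Suppose the fitted function has effective support above `n²`. At most `n² - n` values have mass
above `1/(n² - n)`; adding the `n` training values gives a set `T` of at most `n²` values, so the
forecast of a fresh point misses `T` with probability above `γ`. On that region the expected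
absolute residual is at least `σ²_γ(P)` (`effVar_le`). A fresh point there differs in forecast from
all training points, and from the remaining points with probability at least `e⁻⁸`, its forecast
value being light. Hence (1/4) `e⁻⁸ σ²_γ(P)` times the probability of large support is at most the
worst-case error (`effVar_mul_measure_le`). -/

lemma label_nonneg (z : 𝒳 × I) : 0 ≤ label z := z.2.2.1

lemma label_le_one (z : 𝒳 × I) : label z ≤ 1 := z.2.2.2

/-- The signed residual `Y - f(X)`. -/
def residual (f : 𝒳 → I) (z : 𝒳 × I) : ℝ := label z - (f z.1 : ℝ)

lemma abs_residual_le_one (f : 𝒳 → I) (z : 𝒳 × I) : |residual f z| ≤ 1 := by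
  have h₁ := label_nonneg z
  have h₂ := label_le_one z
  have h₃ := (f z.1).2.1
  have h₄ := (f z.1).2.2
  rw [residual, abs_le]
  constructor <;> linarith

lemma abs_label_le_one (z : 𝒳 × I) : |label z| ≤ 1 := by
  rw [abs_of_nonneg (label_nonneg z)]; exact label_le_one z

lemma abs_forecast_le_one (f : 𝒳 → I) (z : 𝒳 × I) : |(f z.1 : ℝ)| ≤ 1 := by
  rw [abs_of_nonneg (f z.1).2.1]; exact (f z.1).2.2

variable [MeasurableSpace 𝒳]

lemma measurable_label : Measurable (label : 𝒳 × I → ℝ) :=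
  measurable_subtype_coe.comp measurable_snd

lemma measurable_forecast {f : 𝒳 → I} (hf : Measurable f) :
    Measurable fun z : 𝒳 × I => (f z.1 : ℝ) :=
  measurable_subtype_coe.comp (hf.comp measurable_fst)

lemma measurable_residual {f : 𝒳 → I} (hf : Measurable f) : Measurable (residual f) :=
  measurable_label.sub (measurable_forecast hf)

lemma integrable_of_abs_le_one {α : Type*} [MeasurableSpace α] (μ : Measure α) [IsFiniteMeasure μ]
    {g : α → ℝ} (hg : Measurable g) (h : ∀ a, |g a| ≤ 1) : Integrable g μ :=
  Integrable.of_bound hg.aestronglyMeasurable 1 (ae_of_all _ h)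

/-- The calibration error dominates the sum of the absolute mean residuals over any finite set of
level sets of the forecast. -/
lemma sum_abs_setIntegral_residual_le_ece (P : Measure (𝒳 × I)) [IsProbabilityMeasure P]
    {f : 𝒳 → I} (hf : Measurable f) (T : Finset I) :
    ∑ t ∈ T, |∫ z in {z : 𝒳 × I | f z.1 = t}, residual f z ∂P| ≤ ece P f := by
  have hlab : Integrable (label : 𝒳 × I → ℝ) P :=
    integrable_of_abs_le_one P measurable_label abs_label_le_one
  have hfor : Integrable (fun z : 𝒳 × I => (f z.1 : ℝ)) P :=
    integrable_of_abs_le_one P (measurable_forecast hf) (abs_forecast_le_one f)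
  set m : MeasurableSpace (𝒳 × I) :=
    MeasurableSpace.comap (fun z : 𝒳 × I => f z.1) inferInstance with hm
  have hle : m ≤ Prod.instMeasurableSpace := (hf.comp measurable_fst).comap_le
  have hmeas : ∀ t, MeasurableSet[m] {z : 𝒳 × I | f z.1 = t} := fun t =>
    ⟨{t}, measurableSet_singleton t, rfl⟩
  have hint : Integrable (fun z => (P[label | m]) z - (f z.1 : ℝ)) P :=
    integrable_condExp.sub hfor
  -- Level sets belong to the σ-algebra generated by the forecast, so there the label and its
  -- conditional mean have equal integrals.
  have hset : ∀ t, ∫ z in {z : 𝒳 × I | f z.1 = t}, residual f z ∂P =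
      ∫ z in {z : 𝒳 × I | f z.1 = t}, ((P[label | m]) z - (f z.1 : ℝ)) ∂P := fun t => by
    rw [integral_sub integrable_condExp.integrableOn hfor.integrableOn,
      setIntegral_condExp hle hlab (hmeas t)]
    exact integral_sub hlab.integrableOn hfor.integrableOn
  calc ∑ t ∈ T, |∫ z in {z : 𝒳 × I | f z.1 = t}, residual f z ∂P|
      ≤ ∑ t ∈ T, ∫ z in {z : 𝒳 × I | f z.1 = t}, |(P[label | m]) z - (f z.1 : ℝ)| ∂P :=
        Finset.sum_le_sum fun t _ => by
          rw [hset t]; exact abs_integral_le_integral_abs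
    _ = ∫ z in ⋃ t ∈ T, {z : 𝒳 × I | f z.1 = t}, |(P[label | m]) z - (f z.1 : ℝ)| ∂P := by
        refine (integral_biUnion_finset T (fun t _ => hle _ (hmeas t)) ?_
          fun t _ => hint.abs.integrableOn).symm
        intro s _ t _ hst
        exact Set.disjoint_left.2 fun z hs ht => hst (hs.symm.trans ht)
    _ ≤ ece P f := setIntegral_le_integral hint.abs (ae_of_all _ fun _ => abs_nonneg _)

/-! ### Empirical laws and isolated points -/

/-- The uniform distribution on `Fin N`. -/
noncomputable def uniformFin (N : ℕ) : Measure (Fin N) := (N : ℝ≥0∞)⁻¹ • Measure.count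

lemma uniformFin_singleton {N : ℕ} (i : Fin N) : uniformFin N {i} = (N : ℝ≥0∞)⁻¹ := by
  simp [uniformFin]

instance isProbabilityMeasure_uniformFin (N : ℕ) [NeZero N] :
    IsProbabilityMeasure (uniformFin N) := ⟨by
  simp [uniformFin, Measure.count_apply_finite, ENNReal.inv_mul_cancel, NeZero.ne N]⟩

/-- The empirical distribution of a finite sample. -/
noncomputable def empirical {N : ℕ} (w : Fin N → 𝒳 × I) : Measure (𝒳 × I) := (uniformFin N).map w

instance isProbabilityMeasure_empirical {N : ℕ} [NeZero N] (w : Fin N → 𝒳 × I) :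
    IsProbabilityMeasure (empirical w) :=
  Measure.isProbabilityMeasure_map (measurable_of_finite w).aemeasurable

open Classical in
/-- The absolute residual at the `i`-th sample point if the forecast separates it from the other
sample points, and `0` otherwise. -/
noncomputable def isolatedLoss {N : ℕ} (f : 𝒳 → I) (w : Fin N → 𝒳 × I) (i : Fin N) : ℝ≥0∞ :=
  if ∀ j, j ≠ i → f (w j).1 ≠ f (w i).1 then ENNReal.ofReal |residual f (w i)| else 0

/-- On an empirical distribution, isolated sample points contribute their full residual to the
calibration error. -/
lemma sum_isolatedLoss_le_ece {N : ℕ} [NeZero N] {f : 𝒳 → I} (hf : Measurable f)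
    (w : Fin N → 𝒳 × I) :
    ∑ i, (N : ℝ≥0∞)⁻¹ * isolatedLoss f w i ≤ ENNReal.ofReal (ece (empirical w) f) := by
  classical
  set F : Finset (Fin N) := {i | ∀ j, j ≠ i → f (w j).1 ≠ f (w i).1} with hF
  have hinj : Set.InjOn (fun i => f (w i).1) F := by
    intro i hi j hj hij
    by_contra hne
    exact (Finset.mem_filter.1 hj).2 i hne hij
  -- The level set of an isolated point holds one atom, of mass `1/N`, so nothing cancels.
  have hval : ∀ i ∈ F, ∫ z in {z : 𝒳 × I | f z.1 = f (w i).1}, residual f z ∂(empirical w) =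
      (N : ℝ)⁻¹ * residual f (w i) := by
    intro i hi
    have hpre : w ⁻¹' {z : 𝒳 × I | f z.1 = f (w i).1} = {i} := by
      ext j
      simp only [Set.mem_preimage, Set.mem_ofPred_eq, Set.mem_singleton_iff]
      refine ⟨fun h => ?_, fun h => by rw [h]⟩
      by_contra hne
      exact (Finset.mem_filter.1 hi).2 j hne h
    have hlev : MeasurableSet {z : 𝒳 × I | f z.1 = f (w i).1} :=
      (hf.comp measurable_fst) (measurableSet_singleton _)
    rw [empirical, setIntegral_map hlev
      (measurable_residual hf).aestronglyMeasurable (measurable_of_finite w).aemeasurable, hpre,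
      integral_singleton, measureReal_def, uniformFin_singleton]
    simp
  have key := sum_abs_setIntegral_residual_le_ece (empirical w) hf (F.image fun i => f (w i).1)
  rw [Finset.sum_image hinj] at key
  calc ∑ i, (N : ℝ≥0∞)⁻¹ * isolatedLoss f w i
      = ∑ i ∈ F, (N : ℝ≥0∞)⁻¹ * ENNReal.ofReal |residual f (w i)| := by
        rw [hF, Finset.sum_filter]
        refine Finset.sum_congr rfl fun i _ => ?_
        unfold isolatedLoss
        split_ifs <;> simp
    _ = ∑ i ∈ F, ENNReal.ofReal
          |∫ z in {z : 𝒳 × I | f z.1 = f (w i).1}, residual f z ∂(empirical w)| := by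
        refine Finset.sum_congr rfl fun i hi => ?_
        rw [hval i hi, abs_mul, abs_of_nonneg (by positivity : (0 : ℝ) ≤ (N : ℝ)⁻¹), ENNReal.ofReal_mul (by positivity),
          ENNReal.ofReal_inv_of_pos (by exact_mod_cast NeZero.pos N), ENNReal.ofReal_natCast]
    _ ≤ ENNReal.ofReal (ece (empirical w) f) := by
        rw [← ENNReal.ofReal_sum_of_nonneg fun _ _ => abs_nonneg _]
        exact ENNReal.ofReal_le_ofReal key

/-! ### Effective variability, heavy values and effective support -/

/-- Among forecasts based on `X`, the conditional mean minimizes the squared error, so the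
integrated conditional variance is at most the absolute error. -/
lemma setIntegral_condVar_le (P : Measure (𝒳 × I)) [IsProbabilityMeasure P]
    {f : 𝒳 → I} (hf : Measurable f) {A : Set 𝒳} (hA : MeasurableSet A) :
    ∫ z in {z : 𝒳 × I | z.1 ∈ A},
      (Var[label; P | MeasurableSpace.comap (Prod.fst : 𝒳 × I → 𝒳) inferInstance]) z ∂P ≤
    ∫ z in {z : 𝒳 × I | z.1 ∈ A}, |residual f z| ∂P := by
  have hlab : Integrable (label : 𝒳 × I → ℝ) P :=
    integrable_of_abs_le_one P measurable_label abs_label_le_one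
  have hfor : Integrable (fun z : 𝒳 × I => (f z.1 : ℝ)) P :=
    integrable_of_abs_le_one P (measurable_forecast hf) (abs_forecast_le_one f)
  have hresint : Integrable (residual f) P :=
    integrable_of_abs_le_one P (measurable_residual hf) (abs_residual_le_one f)
  have hsq : ∀ z, residual f z ^ 2 ≤ |residual f z| := fun z => by
    rw [← sq_abs]
    nlinarith [abs_nonneg (residual f z), abs_residual_le_one f z]
  have hsqint : Integrable (residual f ^ 2) P :=
    integrable_of_abs_le_one P ((measurable_residual hf).pow_const 2) fun z => by
      simp only [Pi.pow_apply]
      rw [abs_of_nonneg (sq_nonneg _)]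
      exact (hsq z).trans (abs_residual_le_one f z)
  have hL2 : MemLp (residual f) 2 P :=
    MemLp.of_bound (measurable_residual hf).aestronglyMeasurable 1
      (ae_of_all _ (abs_residual_le_one f))
  set m : MeasurableSpace (𝒳 × I) :=
    MeasurableSpace.comap (Prod.fst : 𝒳 × I → 𝒳) inferInstance with hm
  have hle : m ≤ Prod.instMeasurableSpace := measurable_fst.comap_le
  have hAm : MeasurableSet[m] {z : 𝒳 × I | z.1 ∈ A} := ⟨A, hA, rfl⟩
  have hform : StronglyMeasurable[m] (fun z : 𝒳 × I => (f z.1 : ℝ)) :=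
    (measurable_subtype_coe.comp (hf.comp (comap_measurable _))).stronglyMeasurable
  have hce : P[residual f | m] =ᵐ[P] P[label | m] - fun z : 𝒳 × I => (f z.1 : ℝ) := by
    have := condExp_sub (m := m) hlab hfor
    rwa [condExp_of_stronglyMeasurable hle hform hfor] at this
  -- Subtracting a function of `X` leaves the conditional variance given `X` unchanged.
  have hvar : Var[residual f; P | m] =ᵐ[P] Var[label; P | m] := by
    refine condExp_congr_ae ?_
    filter_upwards [hce] with z hz
    simp only [Pi.pow_apply, Pi.sub_apply, residual] at hz ⊢
    rw [hz]
    ring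
  calc ∫ z in {z : 𝒳 × I | z.1 ∈ A}, (Var[label; P | m]) z ∂P
      = ∫ z in {z : 𝒳 × I | z.1 ∈ A}, (Var[residual f; P | m]) z ∂P :=
        integral_congr_ae (ae_restrict_of_ae hvar.symm)
    _ ≤ ∫ z in {z : 𝒳 × I | z.1 ∈ A}, (P[residual f ^ 2 | m]) z ∂P :=
        setIntegral_mono_ae integrable_condVar.integrableOn integrable_condExp.integrableOn
          (condVar_ae_le_condExp_sq hle hL2)
    _ = ∫ z in {z : 𝒳 × I | z.1 ∈ A}, (residual f ^ 2) z ∂P :=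
        setIntegral_condExp hle hsqint hAm
    _ ≤ ∫ z in {z : 𝒳 × I | z.1 ∈ A}, |residual f z| ∂P :=
        integral_mono hsqint.integrableOn hresint.abs.integrableOn hsq

/-- The effective variability is a lower bound for the absolute error of any forecast over any
region of mass at least `γ`. -/
lemma effVar_le (P : Measure (𝒳 × I)) [IsProbabilityMeasure P] {γ : ℝ}
    {f : 𝒳 → I} (hf : Measurable f) {A : Set 𝒳} (hA : MeasurableSet A)
    (hγ : γ ≤ P.real {z | z.1 ∈ A}) :
    effVar γ P ≤ ∫ z in {z : 𝒳 × I | z.1 ∈ A}, |residual f z| ∂P := by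
  refine le_trans (csInf_le ⟨0, ?_⟩ ⟨A, hA, hγ, rfl⟩) (setIntegral_condVar_le P hf hA)
  rintro v ⟨B, -, -, rfl⟩
  refine setIntegral_nonneg_of_ae ?_
  exact condExp_nonneg (ae_of_all _ fun z => by simp only [Pi.pow_apply]; positivity)

lemma effVar_le_one (P : Measure (𝒳 × I)) [IsProbabilityMeasure P] {γ : ℝ} (hγ : γ ≤ 1) :
    effVar γ P ≤ 1 := by
  refine (effVar_le P (f := fun _ => 0) measurable_const MeasurableSet.univ
    (by simpa using hγ)).trans ?_
  have := integral_mono (μ := P)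
    (integrable_of_abs_le_one P (measurable_residual (f := fun _ : 𝒳 => (0 : I)) measurable_const)
      (abs_residual_le_one _)).abs (integrable_const (1 : ℝ)) (abs_residual_le_one _)
  simpa using this

/-- At most `m` values have probability more than `1 / m`. -/
lemma exists_finset_heavy (P : Measure (𝒳 × I)) [IsProbabilityMeasure P] {f : 𝒳 → I}
    (hf : Measurable f) {m : ℕ} (hm : 0 < m) :
    ∃ H : Finset I, H.card ≤ m ∧
      ∀ t ∉ H, P.real {z | f z.1 = t} ≤ (m : ℝ)⁻¹ := by
  have hbound : ∀ T : Finset I, (T : Set I) ⊆ {t | (m : ℝ)⁻¹ < P.real {z | f z.1 = t}} →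
      T.card ≤ m := by
    intro T hT
    have hsum : ∑ t ∈ T, P.real {z : 𝒳 × I | f z.1 = t} ≤ 1 := by
      rw [← measureReal_biUnion_finset]
      · exact measureReal_le_one
      · intro s _ t _ hst
        exact Set.disjoint_left.2 fun z hs ht => hst (hs.symm.trans ht)
      · exact fun t _ => (hf.comp measurable_fst) (measurableSet_singleton t)
    have hlow : T.card • (m : ℝ)⁻¹ ≤ ∑ t ∈ T, P.real {z : 𝒳 × I | f z.1 = t} :=
      Finset.card_nsmul_le_sum _ _ _ fun t ht => (hT ht).le
    have hm' : (0 : ℝ) < m := by exact_mod_cast hm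
    have := hlow.trans hsum
    rw [nsmul_eq_mul, ← div_eq_mul_inv, div_le_one hm'] at this
    exact_mod_cast this
  have hfin : {t | (m : ℝ)⁻¹ < P.real {z : 𝒳 × I | f z.1 = t}}.Finite := by
    by_contra hinf
    obtain ⟨T, hT, hcard⟩ := Set.Infinite.exists_subset_card_eq hinf (m + 1)
    have := hbound T hT
    omega
  refine ⟨hfin.toFinset, hbound _ (by simp), fun t ht => ?_⟩
  simpa using ht

/-- If the effective support has more than `k` points, every set of at most `k` values is missed
with probability more than `γ`. -/
lemma lt_measureReal_of_lt_effSupp (P : Measure (𝒳 × I)) [IsProbabilityMeasure P] {γ : ℝ}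
    {f : 𝒳 → I} (hf : Measurable f) {k : ℕ} (hk : 1 ≤ k) (h : ¬ effSupp γ f P ≤ (k : ℕ∞))
    {T : Finset I} (hT : T.card ≤ k) : γ < P.real {z | f z.1 ∉ T} := by
  by_contra! hle
  apply h
  have : Infinite I := (Set.Icc_infinite zero_lt_one).to_subtype
  -- `effSupp` asks for lists indexed by `Fin k`, so `T` is padded to exactly `k` values, which the
  -- infinite set `I` allows.
  obtain ⟨S, hTS, hS⟩ := Infinite.exists_superset_card_eq T k hT
  refine iInf₂_le_of_le k ⟨hk, S.orderEmbOfFin hS, ?_⟩ le_rfl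
  rw [Finset.range_orderEmbOfFin]
  have hmeas : MeasurableSet {z : 𝒳 × I | f z.1 ∈ T} :=
    (hf.comp measurable_fst) T.measurableSet
  have hcompl : P.real {z : 𝒳 × I | f z.1 ∉ T} = 1 - P.real {z : 𝒳 × I | f z.1 ∈ T} :=
    probReal_compl_eq_one_sub hmeas
  have hmono : P.real {z : 𝒳 × I | f z.1 ∈ T} ≤ P.real {z : 𝒳 × I | f z.1 ∈ (S : Set I)} :=
    measureReal_mono fun z hz => hTS hz
  linarith

end Calibration

/-! ### Fresh points under sample splitting -/

namespace Calibration

section SampleSplitting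

variable {Z ι : Type*} [MeasurableSpace Z] [Fintype ι] {n : ℕ}

/-- The coordinates of an i.i.d. sample along an injection `s`, at a further index `i`, and at all
remaining indices are independent i.i.d. samples. -/
lemma measurePreserving_split (P : Measure Z) [IsProbabilityMeasure P] {s : Fin n → ι}
    (hs : Function.Injective s) {i : ι} (hi : i ∉ Set.range s)
    [Fintype {j // j ≠ i ∧ j ∉ Set.range s}] :
    MeasurePreserving
      (fun w : ι → Z => (w ∘ s, w i, fun j : {j // j ≠ i ∧ j ∉ Set.range s} => w j))
      (Measure.pi fun _ => P)
      ((Measure.pi fun _ => P).prod (P.prod (Measure.pi fun _ => P))) := by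
  have hbij : Function.Bijective (Sum.elim s (Sum.elim (fun _ : Unit => i)
      (Subtype.val : {j // j ≠ i ∧ j ∉ Set.range s} → ι))) := by
    constructor
    · rintro (a | a | a) (b | b | b) hab <;> simp only [Sum.elim_inl, Sum.elim_inr] at hab
      · rw [hs hab]
      · exact absurd ⟨a, hab⟩ hi
      · exact absurd ⟨a, hab⟩ b.2.2
      · exact absurd ⟨b, hab.symm⟩ hi
      · rfl
      · exact absurd hab.symm b.2.1
      · exact absurd ⟨b, hab.symm⟩ a.2.2
      · exact absurd hab a.2.1
      · rw [Subtype.ext hab]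
    · intro j
      by_cases hj : j ∈ Set.range s
      · obtain ⟨a, rfl⟩ := hj
        exact ⟨.inl a, rfl⟩
      by_cases hji : j = i
      · exact ⟨.inr (.inl ()), hji.symm⟩
      · exact ⟨.inr (.inr ⟨j, hji, hj⟩), rfl⟩
  have h₁ := (measurePreserving_piCongrLeft (fun _ : ι => P) (Equiv.ofBijective _ hbij)).symm
  have h₂ := measurePreserving_sumPiEquivProdPi
    (fun _ : Fin n ⊕ (Unit ⊕ {j // j ≠ i ∧ j ∉ Set.range s}) => P)
  have h₃ := measurePreserving_sumPiEquivProdPi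
    (fun _ : Unit ⊕ {j // j ≠ i ∧ j ∉ Set.range s} => P)
  have h₄ := (measurePreserving_funUnique P Unit).prod
    (MeasurePreserving.id (Measure.pi fun _ : {j // j ≠ i ∧ j ∉ Set.range s} => P))
  have h₅ := (MeasurePreserving.id (Measure.pi fun _ : Fin n => P)).prod (h₄.comp h₃)
  exact h₅.comp (h₂.comp h₁)

end SampleSplitting

variable {𝒳 : Type*}

open Classical in
/-- The absolute residual at a test point `z` if the forecast separates it from the sample points
`D` and `r`, and `0` otherwise. -/
noncomputable def separatedLoss {α β : Type*} (f : 𝒳 → I) (D : α → 𝒳 × I) (z : 𝒳 × I)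
    (r : β → 𝒳 × I) : ℝ≥0∞ :=
  if (∀ a, f (D a).1 ≠ f z.1) ∧ ∀ b, f (r b).1 ≠ f z.1 then ENNReal.ofReal |residual f z| else 0

lemma isolatedLoss_eq_separatedLoss {N n : ℕ} (f : 𝒳 → I) (w : Fin N → 𝒳 × I) {s : Fin n → Fin N}
    {i : Fin N} (hi : i ∉ Set.range s) :
    isolatedLoss f w i =
      separatedLoss f (w ∘ s) (w i) (fun j : {j // j ≠ i ∧ j ∉ Set.range s} => w j) := by
  unfold isolatedLoss separatedLoss
  congr 1
  refine propext ⟨fun h => ⟨fun a => h _ fun e => hi ⟨a, e⟩, fun b => h _ b.2.1⟩, ?_⟩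
  rintro ⟨h₁, h₂⟩ j hj
  by_cases hjs : j ∈ Set.range s
  · obtain ⟨a, rfl⟩ := hjs
    exact h₁ a
  · exact h₂ ⟨j, hj, hjs⟩

variable [MeasurableSpace 𝒳]

/-- Data and evaluation point may vary together, as they do when both are read off one ghost sample.
-/
lemma Algorithm.JointlyMeasurable.comp {𝒜 : Algorithm 𝒳} (h𝒜 : 𝒜.JointlyMeasurable) {n : ℕ}
    {Ω : Type*} [MeasurableSpace Ω] {D : Ω → Fin n → 𝒳 × I} (hD : Measurable D)
    {z : Ω → 𝒳 × I} (hz : Measurable z) : Measurable fun ω => (𝒜 n (D ω)).1 (z ω).1 :=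
  (h𝒜 n).comp (hD.prodMk (measurable_fst.comp hz))

lemma Algorithm.JointlyMeasurable.measurable_residual {𝒜 : Algorithm 𝒳}
    (h𝒜 : 𝒜.JointlyMeasurable) {n : ℕ}
    {Ω : Type*} [MeasurableSpace Ω] {D : Ω → Fin n → 𝒳 × I} (hD : Measurable D)
    {z : Ω → 𝒳 × I} (hz : Measurable z) :
    Measurable fun ω => ENNReal.ofReal |residual (𝒜 n (D ω)).1 (z ω)| := by
  refine ENNReal.measurable_ofReal.comp (Measurable.abs ?_)
  exact (measurable_label.comp hz).sub (measurable_subtype_coe.comp (h𝒜.comp hD hz))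

lemma measurable_separatedLoss {𝒜 : Algorithm 𝒳} (h𝒜 : 𝒜.JointlyMeasurable) {n : ℕ}
    {β : Type*} [Finite β] {Ω : Type*} [MeasurableSpace Ω]
    {D : Ω → Fin n → 𝒳 × I} (hD : Measurable D) {z : Ω → 𝒳 × I} (hz : Measurable z)
    {r : Ω → β → 𝒳 × I} (hr : Measurable r) :
    Measurable fun ω => separatedLoss (𝒜 n (D ω)).1 (D ω) (z ω) (r ω) := by
  refine Measurable.ite ?_ (h𝒜.measurable_residual hD hz) measurable_const
  refine MeasurableSet.congr
    (s := (⋂ a, {ω | (𝒜 n (D ω)).1 (D ω a).1 = (𝒜 n (D ω)).1 (z ω).1}ᶜ) ∩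
      ⋂ b, {ω | (𝒜 n (D ω)).1 (r ω b).1 = (𝒜 n (D ω)).1 (z ω).1}ᶜ)
    ((MeasurableSet.iInter fun a => ?_).inter (MeasurableSet.iInter fun b => ?_)) (by ext ω; simp)
  · exact (measurableSet_eq_fun (h𝒜.comp hD ((measurable_pi_apply a).comp hD))
      (h𝒜.comp hD hz)).compl
  · exact (measurableSet_eq_fun (h𝒜.comp hD ((measurable_pi_apply b).comp hr))
      (h𝒜.comp hD hz)).compl

lemma measurable_isolatedLoss {𝒜 : Algorithm 𝒳} (h𝒜 : 𝒜.JointlyMeasurable) {n N : ℕ}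
    {Ω : Type*} [MeasurableSpace Ω] {D : Ω → Fin n → 𝒳 × I} (hD : Measurable D)
    {w : Ω → Fin N → 𝒳 × I} (hw : Measurable w) (i : Fin N) :
    Measurable fun ω => isolatedLoss (𝒜 n (D ω)).1 (w ω) i := by
  have hwi : ∀ j, Measurable fun ω => w ω j := fun j => (measurable_pi_apply j).comp hw
  refine Measurable.ite ?_ (h𝒜.measurable_residual hD (hwi i)) measurable_const
  refine MeasurableSet.congr
    (s := ⋂ (j) (_ : j ≠ i), {ω | (𝒜 n (D ω)).1 (w ω j).1 = (𝒜 n (D ω)).1 (w ω i).1}ᶜ)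
    (MeasurableSet.iInter fun j => MeasurableSet.iInter fun _ => ?_) (by ext ω; simp)
  exact (measurableSet_eq_fun (h𝒜.comp hD (hwi j)) (h𝒜.comp hD (hwi i))).compl

/-- A fresh point falling outside `T`, where all values have mass at most `δ`, is separated from
`N` further fresh points with probability at least `(1 - δ) ^ N`. -/
lemma le_lintegral_separatedLoss (P : Measure (𝒳 × I)) [IsProbabilityMeasure P] {f : 𝒳 → I}
    (hf : Measurable f) {α β : Type*} [Fintype β] (D : α → 𝒳 × I) {T : Finset I}
    (hD : ∀ a, f (D a).1 ∈ T) {δ : ℝ} (hδ₀ : 0 ≤ δ) (hδ : δ ≤ 1)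
    (hT : ∀ t ∉ T, P.real {z | f z.1 = t} ≤ δ) {N : ℕ} (hN : Fintype.card β ≤ N) :
    ENNReal.ofReal ((1 - δ) ^ N * ∫ z in {z : 𝒳 × I | f z.1 ∉ T}, |residual f z| ∂P) ≤
      ∫⁻ z, ∫⁻ r, separatedLoss f D z r ∂(Measure.pi fun _ : β => P) ∂P := by
  have hAT : MeasurableSet {z : 𝒳 × I | f z.1 ∉ T} :=
    ((hf.comp measurable_fst) T.measurableSet).compl
  have hint : Integrable (fun z => |residual f z|) P :=
    (integrable_of_abs_le_one P (measurable_residual hf) (abs_residual_le_one f)).abs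
  rw [ENNReal.ofReal_mul (pow_nonneg (by linarith) _),
    ofReal_integral_eq_lintegral_ofReal hint.integrableOn (ae_of_all _ fun _ => abs_nonneg _),
    ← lintegral_const_mul _ (measurable_residual hf).abs.ennreal_ofReal]
  refine le_trans (setLIntegral_mono' hAT fun z hz => ?_) (setLIntegral_le_lintegral _ _)
  set S : Set (𝒳 × I) := {y | f y.1 = f z.1} with hS
  have hSm : MeasurableSet S := (hf.comp measurable_fst) (measurableSet_singleton _)
  -- Since the forecast at `z` is outside `T`, its level set has mass at most `δ`, and the fresh
  -- points avoid it independently.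
  have hprob : ENNReal.ofReal ((1 - δ) ^ N) ≤
      (Measure.pi fun _ : β => P) (Set.univ.pi fun _ => Sᶜ) := by
    have hSc : ENNReal.ofReal (1 - δ) ≤ P Sᶜ := by
      rw [← ofReal_measureReal, probReal_compl_eq_one_sub hSm]
      exact ENNReal.ofReal_le_ofReal (by linarith [hT _ hz])
    rw [Measure.pi_pi, Finset.prod_const, ENNReal.ofReal_pow (by linarith)]
    calc ENNReal.ofReal (1 - δ) ^ N ≤ ENNReal.ofReal (1 - δ) ^ Fintype.card β :=
          pow_le_pow_of_le_one zero_le (ENNReal.ofReal_le_one.2 (by linarith)) hN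
      _ ≤ P Sᶜ ^ Fintype.card β := pow_le_pow_left' hSc _
      _ = _ := rfl
  calc ENNReal.ofReal ((1 - δ) ^ N) * ENNReal.ofReal |residual f z|
      ≤ ENNReal.ofReal |residual f z| *
          (Measure.pi fun _ : β => P) (Set.univ.pi fun _ => Sᶜ) := by
        rw [mul_comm]; gcongr
    _ = ∫⁻ _ in Set.univ.pi fun _ : β => Sᶜ, ENNReal.ofReal |residual f z|
          ∂(Measure.pi fun _ : β => P) := by rw [setLIntegral_const]
    _ ≤ ∫⁻ r in Set.univ.pi fun _ : β => Sᶜ, separatedLoss f D z r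
          ∂(Measure.pi fun _ : β => P) := by
        refine setLIntegral_mono' (MeasurableSet.univ_pi fun _ => hSm.compl) fun r hr => ?_
        rw [separatedLoss, if_pos]
        exact ⟨fun a h => hz (h ▸ hD a), fun b => hr b (Set.mem_univ b)⟩
    _ ≤ _ := setLIntegral_le_lintegral _ _

/-- For `n ≥ 2`, `n² - n ≥ n²/2` gives `x ≤ 2/n² ≤ 1/2`, where `log (1 - x) ≥ -2x`; the exponent is
then at least `-4n²x ≥ -8`. -/
lemma exp_neg_eight_le {n : ℕ} (hn : 2 ≤ n) :
    Real.exp (-8) ≤ (1 - ((n ^ 2 - n : ℕ) : ℝ)⁻¹) ^ (2 * n ^ 2) := by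
  have hn' : (2 : ℝ) ≤ n := by exact_mod_cast hn
  have hle : n ≤ n ^ 2 := Nat.le_self_pow two_ne_zero n
  set x : ℝ := ((n ^ 2 - n : ℕ) : ℝ)⁻¹ with hx
  have hx₂ : x ≤ 2 / (n : ℝ) ^ 2 := by
    rw [hx, Nat.cast_sub hle, Nat.cast_pow, inv_eq_one_div,
      div_le_div_iff₀ (by nlinarith) (by positivity)]
    nlinarith
  have hx₀ : 0 ≤ x := by positivity
  have hsq : x * (n : ℝ) ^ 2 ≤ 2 := (le_div_iff₀ (by positivity)).1 hx₂
  have hhalf : x ≤ 1 / 2 := by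
    refine hx₂.trans ?_
    rw [div_le_div_iff₀ (by positivity) two_pos]
    nlinarith
  have hpos : 0 < 1 - x := by linarith
  have hlog : -(2 * x) ≤ Real.log (1 - x) := by
    refine le_trans ?_ (Real.one_sub_inv_le_log_of_pos hpos)
    have hinv : (1 - x)⁻¹ ≤ 1 + 2 * x := by
      rw [inv_le_iff_one_le_mul₀ hpos]
      nlinarith
    linarith
  rw [← Real.exp_log (pow_pos hpos _), Real.log_pow, Real.exp_le_exp]
  push_cast
  have := mul_le_mul_of_nonneg_left hlog (by positivity : (0 : ℝ) ≤ 2 * (n : ℝ) ^ 2)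
  linarith

/-- If the fitted function often has large effective support, then an independent sample point is
isolated with a residual of the order of the effective variability. -/
lemma le_lintegral_isolatedLoss {𝒜 : Algorithm 𝒳} (h𝒜 : 𝒜.JointlyMeasurable) {n : ℕ} (hn : 2 ≤ n)
    (P : Measure (𝒳 × I)) [IsProbabilityMeasure P] {γ : ℝ} {B : Set (Fin n → 𝒳 × I)}
    (hBm : MeasurableSet B) (hB : ∀ D ∈ B, ¬ effSupp γ (𝒜 n D).1 P ≤ ((n ^ 2 : ℕ) : ℕ∞))
    {s : Fin n → Fin (2 * n ^ 2)} (hs : Function.Injective s) {i : Fin (2 * n ^ 2)}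
    (hi : i ∉ Set.range s) :
    ENNReal.ofReal (Real.exp (-8) * effVar γ P) * iidLaw n P B ≤
      ∫⁻ w, isolatedLoss (𝒜 n (w ∘ s)).1 w i ∂(Measure.pi fun _ => P) := by
  classical
  have hle : n ≤ n ^ 2 := Nat.le_self_pow two_ne_zero n
  have hlt : n < n ^ 2 := by nlinarith
  have hmeas : Measurable fun p : (Fin n → 𝒳 × I) × (𝒳 × I) ×
      ({j // j ≠ i ∧ j ∉ Set.range s} → 𝒳 × I) =>
        separatedLoss (𝒜 n p.1).1 p.1 p.2.1 p.2.2 :=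
    measurable_separatedLoss h𝒜 measurable_fst measurable_snd.fst measurable_snd.snd
  have hsplit : ∫⁻ w, isolatedLoss (𝒜 n (w ∘ s)).1 w i ∂(Measure.pi fun _ => P) =
      ∫⁻ D, ∫⁻ z, ∫⁻ r, separatedLoss (𝒜 n D).1 D z r
        ∂(Measure.pi fun _ : {j // j ≠ i ∧ j ∉ Set.range s} => P) ∂P ∂(iidLaw n P) := by
    simp_rw [fun w : Fin (2 * n ^ 2) → 𝒳 × I =>
      isolatedLoss_eq_separatedLoss (𝒜 n (w ∘ s)).1 w hi]
    refine ((measurePreserving_split P hs hi).lintegral_comp hmeas).trans ?_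
    rw [lintegral_prod _ hmeas.aemeasurable]
    refine lintegral_congr fun D => ?_
    rw [lintegral_prod]
    exact (hmeas.comp measurable_prodMk_left).aemeasurable
  rw [hsplit, ← setLIntegral_const]
  refine le_trans (setLIntegral_mono' hBm fun D hD => ?_) (setLIntegral_le_lintegral _ _)
  set f := (𝒜 n D).1 with hfdef
  have hf : Measurable f := (𝒜 n D).2
  -- The budget of `n²` values is split into `n² - n` heavy ones and `n` seen in training; `n ≥ 2`
  -- keeps the first share positive.
  have hm : 0 < n ^ 2 - n := by omega
  obtain ⟨H, hHcard, hH⟩ := exists_finset_heavy P hf hm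
  set T : Finset I := H ∪ Finset.univ.image fun a => f (D a).1 with hTdef
  have hTcard : T.card ≤ n ^ 2 := by
    have h₁ := Finset.card_union_le H (Finset.univ.image fun a => f (D a).1)
    rw [← hTdef] at h₁
    have h₂ := Finset.card_image_le (s := Finset.univ) (f := fun a => f (D a).1)
    simp only [Finset.card_univ, Fintype.card_fin] at h₂
    omega
  have hγ := (lt_measureReal_of_lt_effSupp P hf (by omega) (hB D hD) hTcard).le
  have hA : MeasurableSet {x | f x ∉ T} := (hf T.measurableSet).compl
  have hbase := effVar_le P hf hA hγ
  have hinv : ((n ^ 2 - n : ℕ) : ℝ)⁻¹ ≤ 1 :=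
    inv_le_one_of_one_le₀ (by exact_mod_cast hm)
  have hcard : Fintype.card {j // j ≠ i ∧ j ∉ Set.range s} ≤ 2 * n ^ 2 := by
    simpa using Fintype.card_subtype_le fun j => j ≠ i ∧ j ∉ Set.range s
  refine le_trans (ENNReal.ofReal_le_ofReal ?_)
    (le_lintegral_separatedLoss P hf D (T := T) (fun a => ?_) (by positivity) hinv
      (fun t ht => hH t fun h => ht (Finset.mem_union_left _ h)) hcard)
  · have hnonneg : 0 ≤ ∫ z in {z : 𝒳 × I | f z.1 ∉ T}, |residual f z| ∂P :=
      integral_nonneg fun _ => abs_nonneg _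
    calc Real.exp (-8) * effVar γ P
        ≤ Real.exp (-8) * ∫ z in {z : 𝒳 × I | f z.1 ∉ T}, |residual f z| ∂P := by
          gcongr; exact hbase
      _ ≤ _ := by gcongr; exact exp_neg_eight_le hn
  · exact Finset.mem_union_right _ (Finset.mem_image_of_mem _ (Finset.mem_univ a))

end Calibration

/-! ### Averaging over the ghost sample -/

namespace Calibration

variable {𝒳 : Type*} [MeasurableSpace 𝒳]

/-- The worst-case expected calibration error at sample size `n`. -/
noncomputable def worstEce (𝒜 : Algorithm 𝒳) (n : ℕ) : ℝ≥0∞ :=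
  ⨆ (P : Measure (𝒳 × I)) (_ : IsProbabilityMeasure P),
    ∫⁻ D, ENNReal.ofReal (ece P (𝒜 n D).1) ∂(iidLaw n P)

/-- Sampling from an empirical distribution is sampling indices uniformly. -/
lemma lintegral_iidLaw_empirical {N n : ℕ} [NeZero N] (w : Fin N → 𝒳 × I)
    {g : (Fin n → 𝒳 × I) → ℝ≥0∞} (hg : Measurable g) :
    ∫⁻ D, g D ∂(iidLaw n (empirical w)) = ∑ s : Fin n → Fin N, (N : ℝ≥0∞)⁻¹ ^ n * g (w ∘ s) := by
  have hw : Measurable w := measurable_of_finite w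
  have : IsProbabilityMeasure ((uniformFin N).map w) := isProbabilityMeasure_empirical w
  have hmap : iidLaw n (empirical w) =
      (Measure.pi fun _ : Fin n => uniformFin N).map fun s => w ∘ s :=
    (Measure.pi_map_pi fun _ => hw.aemeasurable).symm
  rw [hmap, lintegral_map hg (measurable_of_finite _), lintegral_fintype]
  refine Finset.sum_congr rfl fun s _ => ?_
  rw [Measure.pi_singleton]
  simp only [uniformFin_singleton, Finset.prod_const, Finset.card_univ, Fintype.card_fin]
  exact mul_comm _ _

/-- Averaged over an i.i.d. sample `w`, the error of an algorithm trained on subsamples of `w`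
against the empirical distribution of `w` is at most the worst-case error. -/
lemma sum_lintegral_isolatedLoss_le {𝒜 : Algorithm 𝒳} (h𝒜 : 𝒜.JointlyMeasurable) {n N : ℕ}
    [NeZero N] (P : Measure (𝒳 × I)) [IsProbabilityMeasure P] :
    ∑ s : Fin n → Fin N, (N : ℝ≥0∞)⁻¹ ^ n * ∑ i, (N : ℝ≥0∞)⁻¹ *
      ∫⁻ w, isolatedLoss (𝒜 n (w ∘ s)).1 w i ∂(Measure.pi fun _ => P) ≤ worstEce 𝒜 n := by
  have hmeas : ∀ (s : Fin n → Fin N) (i : Fin N),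
      Measurable fun w : Fin N → 𝒳 × I => isolatedLoss (𝒜 n (w ∘ s)).1 w i := fun s i =>
    measurable_isolatedLoss h𝒜 (measurable_pi_lambda _ fun a => measurable_pi_apply (s a))
      measurable_id i
  have hpoint : ∀ w : Fin N → 𝒳 × I, ∑ s : Fin n → Fin N, (N : ℝ≥0∞)⁻¹ ^ n *
      ∑ i, (N : ℝ≥0∞)⁻¹ * isolatedLoss (𝒜 n (w ∘ s)).1 w i ≤ worstEce 𝒜 n := by
    intro w
    rw [← lintegral_iidLaw_empirical w (g := fun D => ∑ i, (N : ℝ≥0∞)⁻¹ *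
      isolatedLoss (𝒜 n D).1 w i) (Finset.measurable_sum _ fun i _ =>
        (measurable_isolatedLoss h𝒜 measurable_id measurable_const i).const_mul _)]
    refine (lintegral_mono fun D => sum_isolatedLoss_le_ece (𝒜 n D).2 w).trans ?_
    -- Uniformity over laws enters here: the empirical law of `w` competes in the supremum.
    exact le_iSup₂_of_le (empirical w) inferInstance le_rfl
  calc ∑ s : Fin n → Fin N, (N : ℝ≥0∞)⁻¹ ^ n * ∑ i, (N : ℝ≥0∞)⁻¹ *
        ∫⁻ w, isolatedLoss (𝒜 n (w ∘ s)).1 w i ∂(Measure.pi fun _ => P)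
      = ∫⁻ w, ∑ s : Fin n → Fin N, (N : ℝ≥0∞)⁻¹ ^ n *
          ∑ i, (N : ℝ≥0∞)⁻¹ * isolatedLoss (𝒜 n (w ∘ s)).1 w i ∂(Measure.pi fun _ => P) := by
        rw [lintegral_finsetSum _ fun s _ => (Finset.measurable_sum _ fun i _ =>
          (hmeas s i).const_mul _).const_mul _]
        refine Finset.sum_congr rfl fun s _ => ?_
        rw [lintegral_const_mul _ (Finset.measurable_sum _ fun i _ => (hmeas s i).const_mul _),
          lintegral_finsetSum _ fun i _ => (hmeas s i).const_mul _]
        congr 1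
        refine Finset.sum_congr rfl fun i _ => ?_
        rw [lintegral_const_mul _ (hmeas s i)]
    _ ≤ ∫⁻ _, worstEce 𝒜 n ∂(Measure.pi fun _ : Fin N => P) := lintegral_mono hpoint
    _ = worstEce 𝒜 n := by simp

lemma inv_two_le_mul_inv {a M : ℕ} (hM : M ≠ 0) (h : M ≤ 2 * a) :
    (2 : ℝ≥0∞)⁻¹ ≤ a * (M : ℝ≥0∞)⁻¹ := by
  rw [← div_eq_mul_inv, ENNReal.le_div_iff_mul_le (.inl (by exact_mod_cast hM))
    (.inl (ENNReal.natCast_ne_top M)), mul_comm, ← div_eq_mul_inv]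
  refine ENNReal.div_le_of_le_mul ?_
  rw [mul_comm]
  exact_mod_cast h

/-- At least half of all `n`-tuples from `2 * n ^ 2` indices have no repetition. -/
lemma pow_le_two_mul_descFactorial {n : ℕ} (hn : 1 ≤ n) :
    (2 * n ^ 2) ^ n ≤ 2 * (2 * n ^ 2).descFactorial n := by
  have hle : n ≤ 2 * n ^ 2 := by nlinarith
  have hn' : (1 : ℝ) ≤ n := by exact_mod_cast hn
  have hbern : (1 : ℝ) / 2 ≤ (1 - 1 / (2 * n)) ^ n := by
    have h2 : (1 : ℝ) / (2 * n) ≤ 1 := by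
      rw [div_le_one (by positivity)]; linarith
    have := one_add_mul_le_pow (a := -(1 / (2 * (n : ℝ)))) (by linarith) n
    rw [← sub_eq_add_neg] at this
    refine le_trans (le_of_eq ?_) this
    field_simp
    norm_num
  have hfac : ((2 * n ^ 2 : ℕ) : ℝ) ^ n * (1 - 1 / (2 * n)) ^ n = ((2 * n ^ 2 - n : ℕ) : ℝ) ^ n := by
    rw [← mul_pow, Nat.cast_sub hle]
    congr 1
    push_cast
    field_simp
  have hdesc : (2 * n ^ 2 - n) ^ n ≤ (2 * n ^ 2).descFactorial n :=
    (Nat.pow_le_pow_left (by omega) n).trans (Nat.pow_sub_le_descFactorial _ _)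
  have hreal : ((2 * n ^ 2 : ℕ) : ℝ) ^ n ≤ 2 * ((2 * n ^ 2 - n : ℕ) : ℝ) ^ n := by
    rw [← hfac]
    nlinarith [pow_nonneg (Nat.cast_nonneg (α := ℝ) (2 * n ^ 2)) n]
  have hnat : (2 * n ^ 2) ^ n ≤ 2 * (2 * n ^ 2 - n) ^ n := by exact_mod_cast hreal
  exact hnat.trans (Nat.mul_le_mul_left 2 hdesc)

/-- The probability of a large effective support, times the effective variability, is bounded by
the worst-case calibration error. -/
lemma effVar_mul_measure_le {𝒜 : Algorithm 𝒳} (h𝒜 : 𝒜.JointlyMeasurable) {n : ℕ} (hn : 2 ≤ n)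
    (P : Measure (𝒳 × I)) [IsProbabilityMeasure P] {γ : ℝ} {B : Set (Fin n → 𝒳 × I)}
    (hBm : MeasurableSet B) (hB : ∀ D ∈ B, ¬ effSupp γ (𝒜 n D).1 P ≤ ((n ^ 2 : ℕ) : ℕ∞)) :
    2⁻¹ * (2⁻¹ * (ENNReal.ofReal (Real.exp (-8) * effVar γ P) * iidLaw n P B)) ≤
      worstEce 𝒜 n := by
  classical
  set K := ENNReal.ofReal (Real.exp (-8) * effVar γ P) * iidLaw n P B with hK
  set N := 2 * n ^ 2 with hN
  have hN₀ : N ≠ 0 := by positivity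
  have : NeZero N := ⟨hN₀⟩
  refine le_trans ?_ (sum_lintegral_isolatedLoss_le h𝒜 (n := n) (N := N) P)
  have hinner : ∀ s : Fin n → Fin N, Function.Injective s →
      2⁻¹ * K ≤ ∑ i, (N : ℝ≥0∞)⁻¹ *
        ∫⁻ w, isolatedLoss (𝒜 n (w ∘ s)).1 w i ∂(Measure.pi fun _ => P) := by
    intro s hs
    have hcard : (Finset.univ \ Finset.univ.image s).card = N - n := by
      rw [Finset.card_sdiff_of_subset (Finset.subset_univ _), Finset.card_image_of_injective _ hs]
      simp
    have hhalf : N ≤ 2 * (Finset.univ \ Finset.univ.image s).card := by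
      rw [hcard]
      have : 2 * n ≤ N := by rw [hN]; nlinarith
      omega
    calc 2⁻¹ * K ≤ ((Finset.univ \ Finset.univ.image s).card * (N : ℝ≥0∞)⁻¹) * K := by
          gcongr; exact inv_two_le_mul_inv hN₀ hhalf
      _ = ∑ i ∈ Finset.univ \ Finset.univ.image s, (N : ℝ≥0∞)⁻¹ * K := by
          rw [Finset.sum_const, nsmul_eq_mul, mul_assoc]
      _ ≤ ∑ i ∈ Finset.univ \ Finset.univ.image s, (N : ℝ≥0∞)⁻¹ *
            ∫⁻ w, isolatedLoss (𝒜 n (w ∘ s)).1 w i ∂(Measure.pi fun _ => P) := by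
          refine Finset.sum_le_sum fun i hi => ?_
          gcongr
          refine le_lintegral_isolatedLoss h𝒜 hn P hBm hB hs ?_
          simpa using hi
      _ ≤ _ := Finset.sum_le_sum_of_subset (Finset.subset_univ _)
  set J : Finset (Fin n → Fin N) := {s | Function.Injective s} with hJ
  have hJcard : J.card = N.descFactorial n := by
    rw [hJ, ← Fintype.card_subtype,
      Fintype.card_congr (Equiv.subtypeInjectiveEquivEmbedding (Fin n) (Fin N)),
      Fintype.card_embedding_eq]
    simp
  calc 2⁻¹ * (2⁻¹ * K) ≤ (J.card * ((N ^ n : ℕ) : ℝ≥0∞)⁻¹) * (2⁻¹ * K) := by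
        gcongr
        refine inv_two_le_mul_inv (pow_ne_zero _ hN₀) ?_
        rw [hJcard]
        exact pow_le_two_mul_descFactorial (by omega)
    _ = ∑ s ∈ J, (N : ℝ≥0∞)⁻¹ ^ n * (2⁻¹ * K) := by
        rw [Finset.sum_const, nsmul_eq_mul, mul_assoc, Nat.cast_pow, ENNReal.inv_pow]
    _ ≤ ∑ s ∈ J, (N : ℝ≥0∞)⁻¹ ^ n * ∑ i, (N : ℝ≥0∞)⁻¹ *
          ∫⁻ w, isolatedLoss (𝒜 n (w ∘ s)).1 w i ∂(Measure.pi fun _ => P) := by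
        refine Finset.sum_le_sum fun s hs => ?_
        gcongr
        exact hinner s (Finset.mem_filter.1 hs).2
    _ ≤ _ := Finset.sum_le_sum_of_subset (Finset.subset_univ _)

/-! ### The rate -/

lemma Algorithm.StronglyAsympCalibrated.tendsto_worstEce {𝒜 : Algorithm 𝒳}
    (h : 𝒜.StronglyAsympCalibrated) : Tendsto (worstEce 𝒜) atTop (𝓝 0) :=
  tendsto_of_le_liminf_of_limsup_le zero_le (le_of_eq h)

/-- The rate: a constant multiple of the worst-case error, truncated at `1`, and `1` for the sample
sizes `0` and `1`. -/
noncomputable def suppRate (𝒜 : Algorithm 𝒳) (n : ℕ) : ℝ :=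
  if 2 ≤ n then (min 1 (ENNReal.ofReal (4 * Real.exp 8) * worstEce 𝒜 n)).toReal else 1

lemma tendsto_suppRate {𝒜 : Algorithm 𝒳} (h : 𝒜.StronglyAsympCalibrated) :
    Tendsto (suppRate 𝒜) atTop (𝓝 0) := by
  have h₁ : Tendsto (fun n => min 1 (ENNReal.ofReal (4 * Real.exp 8) * worstEce 𝒜 n)) atTop
      (𝓝 0) := by
    have := (tendsto_const_nhds (x := (1 : ℝ≥0∞))).min (ENNReal.Tendsto.const_mul
      h.tendsto_worstEce (.inr (ENNReal.ofReal_ne_top (r := 4 * Real.exp 8))))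
    simpa using this
  have h₂ := (ENNReal.tendsto_toReal ENNReal.zero_ne_top).comp h₁
  refine Tendsto.congr' ?_ h₂
  filter_upwards [eventually_ge_atTop 2] with n hn
  simp [suppRate, hn]

/-- Stated for measurable sets `B` of bad samples because the bad event itself is not known to be
measurable. -/
lemma effVar_mul_measureReal_le {𝒜 : Algorithm 𝒳} (h𝒜 : 𝒜.JointlyMeasurable) (n : ℕ)
    (P : Measure (𝒳 × I)) [IsProbabilityMeasure P] {γ : ℝ} (hγ : γ ≤ 1) (hσ : 0 < effVar γ P)
    {B : Set (Fin n → 𝒳 × I)} (hBm : MeasurableSet B)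
    (hB : ∀ D ∈ B, ¬ effSupp γ (𝒜 n D).1 P ≤ ((n ^ 2 : ℕ) : ℕ∞)) :
    effVar γ P * (iidLaw n P).real B ≤ suppRate 𝒜 n := by
  have hone : effVar γ P * (iidLaw n P).real B ≤ 1 :=
    mul_le_one₀ (effVar_le_one P hγ) measureReal_nonneg measureReal_le_one
  rw [suppRate]
  split_ifs with hn
  -- Truncation at `1` makes `toReal` faithful without a bound on `worstEce`; the factor `4e⁸`
  -- undoes the two halves and `e⁻⁸`.
  · rw [← ENNReal.ofReal_le_iff_le_toReal (ne_top_of_le_ne_top ENNReal.one_ne_top (min_le_left _ _)),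
      le_min_iff]
    refine ⟨ENNReal.ofReal_le_one.2 hone, ?_⟩
    have hscale : ENNReal.ofReal (effVar γ P * (iidLaw n P).real B) =
        ENNReal.ofReal (4 * Real.exp 8) *
          (2⁻¹ * (2⁻¹ * (ENNReal.ofReal (Real.exp (-8) * effVar γ P) * iidLaw n P B))) := by
      have htwo : (2 : ℝ≥0∞)⁻¹ = ENNReal.ofReal 2⁻¹ := by
        rw [ENNReal.ofReal_inv_of_pos two_pos, ENNReal.ofReal_ofNat]
      rw [htwo, ← ofReal_measureReal (μ := iidLaw n P) (s := B),
        ← ENNReal.ofReal_mul (by positivity), ← ENNReal.ofReal_mul (by positivity),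
        ← ENNReal.ofReal_mul (by positivity), ← ENNReal.ofReal_mul (by positivity), Real.exp_neg]
      congr 1
      field_simp
      norm_num
    rw [hscale]
    gcongr
    exact effVar_mul_measure_le h𝒜 hn P hBm hB
  · exact hone

end Calibration

theorem corollaryC3 {𝒳 : Type*} [MeasurableSpace 𝒳] (𝒜 : Calibration.Algorithm 𝒳)
    (hmeas : 𝒜.JointlyMeasurable) (hcal : 𝒜.StronglyAsympCalibrated) :
    ∃ ν : ℕ → ℝ, Tendsto ν atTop (𝓝 0) ∧
      ∀ (n : ℕ) (P : Measure (𝒳 × I)) [IsProbabilityMeasure P] (γ : ℝ),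
        0 ≤ γ → γ ≤ 1 → 0 < Calibration.effVar γ P →
        1 - ν n / Calibration.effVar γ P ≤
          (Calibration.iidLaw n P).real
            {D | Calibration.effSupp γ (𝒜 n D).1 P ≤ ((n ^ 2 : ℕ) : ℕ∞)} := by
  refine ⟨Calibration.suppRate 𝒜, Calibration.tendsto_suppRate hcal, ?_⟩
  intro n P _ γ _ hγ hσ
  set G : Set (Fin n → 𝒳 × I) :=
    {D | Calibration.effSupp γ (𝒜 n D).1 P ≤ ((n ^ 2 : ℕ) : ℕ∞)} with hG
  -- `G` need not be measurable: apply the bound to the complement of a measurable hull.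
  have hGm := measurableSet_toMeasurable (Calibration.iidLaw n P) G
  have hkey := Calibration.effVar_mul_measureReal_le hmeas n P hγ hσ hGm.compl
    fun D hD hle => hD (subset_toMeasurable _ G hle)
  have hGreal : (Calibration.iidLaw n P).real (toMeasurable (Calibration.iidLaw n P) G)ᶜ =
      1 - (Calibration.iidLaw n P).real G := by
    rw [probReal_compl_eq_one_sub hGm, measureReal_def, measure_toMeasurable, measureReal_def]
  rw [hGreal, mul_comm, ← le_div_iff₀ hσ] at hkey
  linarith
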